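/- Let $q_o>0$, let $q_\pm\in\mathbb C$ with $|q_\pm|=q_o$, and let $\mathbf q:\mathbb R^2\to\mathbb C^3$ be a classical solution of the defocusing three-component VNLS equation $$i\mathbf q_t+\mathbf q_{xx}-2(\|\mathbf q\|^2-q_o^2)\mathbf q=0$$ with $\mathbf q(x,t)\to\mathbf q_\pm:=(0,0,q_\pm)^T$ as $x\to\pm\infty$ and $\mathbf q(\cdot,t)-\mathbf q_\pm\in L^1(\mathbb R^\pm)$ for all $t$. For $z\in\Sigma:=\mathbb R\setminus\{0,\pm q_o\}$ put $k=\frac12(z+q_o^2/z)$, $\lambda=\frac12(z-q_o^2/z)$, $\mathbf J=\mathrm{diag}(1,-1,-1,-1)$, $\mathbf Q=\begin{pmatrix}0&\mathbf q^\dagger\\ \mathbf q&0\end{pmatrix}$, $\mathbf Q_\pm$ the same matrix with $\mathbf q_\pm$ in place of $\mathbf q$, $\mathbf E_\pm(z)=\mathbf I-\frac iz\mathbf J\mathbf Q_\pm$, and $$\mathbf\Theta(x,t,z)=\mathrm{diag}(-\lambda,k,k,\lambda)\,x-\mathrm{diag}(-2k\lambda,k^2+\lambda^2,k^2+\lambda^2,2k\lambda)\,t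 .$$ Let $\phi_\pm(x,t,z)$, $z\in\Sigma$, be the Jost eigenfunctions: the $4\times4$ matrix solutions of the Lax pair $\phi_x=(-ik\mathbf J+\mathbf Q)\phi$, $\phi_t=(2ik^2\mathbf J-i\mathbf J(\mathbf Q_x-\mathbf Q^2+q_o^2)-2k\mathbf Q)\phi$ with $\phi_\pm=\mathbf E_\pm e^{i\mathbf\Theta}+o(1)$ as $x\to\pm\infty$. The scattering matrices are defined by $\phi_-=\phi_+\mathbf A(z)$ and $\mathbf B(z)=\mathbf A(z)^{-1}$. Denote by $A_{I;K}$ the minor of $\mathbf A$ with rows $I$ and columns $K$, and $A_{[I]}=A_{I;I}$. Define on $\Sigma$ the auxiliary eigenfunctions $$\chi_2^+=A_{[1,2]}\phi_{+,2}+A_{1,3;1,2}\phi_{+,3}+A_{1,4;1,2}\phi_{+,4},\qquad \chi_3^+=A_{[1,2,3]}\phi_{+,3}+A_{1,2,4;1,2,3}\phi_{+,4},$$ $$\chi_2^-=A_{1,3,4;2,3,4}\phi_{+,1}+A_{[2,3,4]}\phi_{+,2},\qquad \chi_3^-=A_{1,4;3,4}\phi_{+,1}+A_{2,4;3,4}\phi_{+,2}+A_{[3,4]}\phi_{+,3}.$$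 Assume that the analytic principal minors $A_{[1]},A_{[1,2]},A_{[1,2,3]},A_{[4]},A_{[3,4]},A_{[2,3,4]}$ have no zeros on $\Sigma$, and put, for $z\in\Sigma$, $$\mathbf M^+=\Big(\frac{\phi_{-,1}}{A_{[1]}},\ \frac1{A_{[1,2]}}\Big(\chi_2^+-\frac{A_{1,3;1,2}}{A_{[1,2,3]}}\chi_3^+\Big),\ \frac{\chi_3^+}{A_{[1,2,3]}},\ \phi_{+,4}\Big)e^{-i\mathbf\Theta},$$ $$\mathbf M^-=\Big(\phi_{+,1},\ \frac{\chi_2^-}{A_{[2,3,4]}},\ \frac1{A_{[3,4]}}\Big(\chi_3^--\frac{A_{2,4;3,4}}{A_{[2,3,4]}}\chi_2^-\Big),\ \frac{\phi_{-,4}}{A_{[4]}}\Big)e^{-i\mathbf\Theta}.$$ **Lemma.** Suppose that the analytic non-principal minors $A_{1,2;1,3}$, $A_{1,3;1,2}$, $A_{2,4;3,4}$, $A_{3,4;2,4}$ vanish identically on $\Sigma$. Then there is exactly one matrix function $\mathbf L(z)$ on $\Sigma$, the jump matrix, with $$\mathbf M^+(x,t,z)=\mathbf M^-(x,t,z)\,\big[\mathbf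 I-e^{i\mathbf\Theta(x,t,z)}\mathbf L(z)e^{-i\mathbf\Theta(x,t,z)}\big]\qquad\text{for all }x,t\in\mathbb R,\ z\in\Sigma,$$ and the scattering matrices $\mathbf A(z)$ and $\mathbf B(z)$ are diagonal for all $z\in\Sigma$ if and only if $\mathbf L(z)=\mathbf 0$ for all $z\in\Sigma$. -/

import Mathlib

open Filter Topology

noncomputable section

/-! Direct scattering for the defocusing three-component vector nonlinear Schroedinger equation
with nonzero boundary values. Matrix indices `0, 1, 2, 3` are the indices `1, 2, 3, 4` of the
usual notation. A potential is a function `q : ℝ → ℝ → Fin 3 → ℂ` of `x` and `t`. -/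

namespace VNLS

/-- Complex `4 × 4` matrices. -/
abbrev Mat4 := Matrix (Fin 4) (Fin 4) ℂ

/-- The vector `(0, 0, c)`, the form of the boundary values of the potential. -/
def bdryVec (c : ℂ) : Fin 3 → ℂ := ![0, 0, c]

/-- Classical solutions of `i q_t + q_xx - 2 (‖q‖² - q₀²) q = 0`. -/
structure IsSolution (q₀ : ℝ) (q : ℝ → ℝ → Fin 3 → ℂ) : Prop where
  contDiff_x : ∀ t j, ContDiff ℝ 2 (fun x => q x t j)
  differentiable_t : ∀ x j, Differentiable ℝ (fun t => q x t j)
  equation : ∀ x t j,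
    Complex.I * deriv (fun s => q x s j) t + iteratedDeriv 2 (fun y => q y t j) x
      - 2 * (((∑ i, ‖q x t i‖ ^ 2 - q₀ ^ 2 : ℝ)) : ℂ) * q x t j = 0

/-- The nonzero boundary conditions: `q(x,t) → (0,0,q₊)` as `x → +∞` and `q(x,t) → (0,0,q₋)` as
`x → -∞`, with integrable differences on the half-lines. -/
structure HasBoundaryValues (qPlus qMinus : ℂ) (q : ℝ → ℝ → Fin 3 → ℂ) : Prop where
  tendsto_top : ∀ t, Tendsto (fun x => q x t) atTop (𝓝 (bdryVec qPlus))
  tendsto_bot : ∀ t, Tendsto (fun x => q x t) atBot (𝓝 (bdryVec qMinus))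
  integrable_top : ∀ t,
    MeasureTheory.IntegrableOn (fun x => q x t - bdryVec qPlus) (Set.Ioi 0)
  integrable_bot : ∀ t,
    MeasureTheory.IntegrableOn (fun x => q x t - bdryVec qMinus) (Set.Iio 0)

/-- The continuous spectrum in the uniformization variable `z`, without the branch points `±q₀`
and the origin. -/
def contSpec (q₀ : ℝ) : Set ℝ := {z | z ≠ 0 ∧ z ≠ q₀ ∧ z ≠ -q₀}

/-- The spectral parameter `k = (z + q₀²/z)/2`. -/
def specK (q₀ z : ℝ) : ℝ := (z + q₀ ^ 2 / z) / 2

/-- `λ = (z - q₀²/z)/2`, so that `λ² = k² - q₀²` and `z = k + λ`. -/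
def specLam (q₀ z : ℝ) : ℝ := (z - q₀ ^ 2 / z) / 2

/-- `J = diag(1, -1, -1, -1)`. -/
def matJ : Mat4 := Matrix.diagonal ![1, -1, -1, -1]

/-- The block matrix with rows `(0, v†)` and `(v, 0)`. -/
def matQ (v : Fin 3 → ℂ) : Mat4 :=
  !![0, star (v 0), star (v 1), star (v 2);
     v 0, 0, 0, 0;
     v 1, 0, 0, 0;
     v 2, 0, 0, 0]

/-- The `x`-part of the Lax pair, `X = -i k J + Q`. -/
def laxX (q₀ : ℝ) (q : ℝ → ℝ → Fin 3 → ℂ) (x t z : ℝ) : Mat4 :=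
  -(Complex.I * (specK q₀ z : ℂ)) • matJ + matQ (q x t)

/-- The `t`-part of the Lax pair, `T = 2 i k² J - i J (Q_x - Q² + q₀²) - 2 k Q`. -/
def laxT (q₀ : ℝ) (q : ℝ → ℝ → Fin 3 → ℂ) (x t z : ℝ) : Mat4 :=
  (2 * Complex.I * (specK q₀ z : ℂ) ^ 2) • matJ
    - Complex.I • (matJ * (matQ (fun j => deriv (fun y => q y t j) x)
        - matQ (q x t) ^ 2 + ((q₀ : ℂ) ^ 2) • (1 : Mat4)))
    - (2 * (specK q₀ z : ℂ)) • matQ (q x t)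

/-- The diagonal of `Θ(x,t,z) = Λ x - Ω t`, where `Λ = diag(-λ, k, k, λ)` and
`Ω = diag(-2kλ, k² + λ², k² + λ², 2kλ)`. -/
def theta (q₀ : ℝ) (x t z : ℝ) : Fin 4 → ℝ :=
  let k := specK q₀ z
  let l := specLam q₀ z
  ![-l * x + 2 * k * l * t, k * x - (k ^ 2 + l ^ 2) * t,
    k * x - (k ^ 2 + l ^ 2) * t, l * x - 2 * k * l * t]

/-- The diagonal matrix `e^{iΘ(x,t,z)}`. -/
def expTheta (q₀ : ℝ) (x t z : ℝ) : Mat4 :=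
  Matrix.diagonal (fun j => Complex.exp (Complex.I * (theta q₀ x t z j : ℂ)))

/-- The diagonal matrix `e^{-iΘ(x,t,z)}`. -/
def expNegTheta (q₀ : ℝ) (x t z : ℝ) : Mat4 :=
  Matrix.diagonal (fun j => Complex.exp (-(Complex.I * (theta q₀ x t z j : ℂ))))

/-- The asymptotic eigenvector matrix `E = I - (i/z) J Q_∞` for the boundary vector `(0,0,c)`. -/
def matE (c : ℂ) (z : ℝ) : Mat4 :=
  1 - (Complex.I / (z : ℂ)) • (matJ * matQ (bdryVec c))

/-- `φ` is the family of Jost eigenfunctions at the end `l` of the real line (`l = atTop` or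
`l = atBot`), where the potential tends to `(0,0,c)`: for every `z` in the continuous spectrum
`φ(·,·,z)` is a matrix solution of both parts of the Lax pair and is `E e^{iΘ} + o(1)` as `x`
tends to that end. These conditions determine `φ` on the continuous spectrum. -/
structure IsJost (q₀ : ℝ) (q : ℝ → ℝ → Fin 3 → ℂ) (c : ℂ) (l : Filter ℝ)
    (φ : ℝ → ℝ → ℝ → Mat4) : Prop where
  eq_x : ∀ z ∈ contSpec q₀, ∀ x t i j,
    HasDerivAt (fun y => φ y t z i j) ((laxX q₀ q x t z * φ x t z) i j) x
  eq_t : ∀ z ∈ contSpec q₀, ∀ x t i j,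
    HasDerivAt (fun s => φ x s z i j) ((laxT q₀ q x t z * φ x t z) i j) t
  asymptotics : ∀ z ∈ contSpec q₀, ∀ t,
    Tendsto (fun x => φ x t z - matE c z * expTheta q₀ x t z) l (𝓝 0)

/-- The scattering matrix `A(z)`, defined by `φ₋(x,t,z) = φ₊(x,t,z) A(z)`. The quotient
`φ₊⁻¹ φ₋` of two matrix solutions of the Lax pair does not depend on `(x,t)`, so it is
evaluated at the origin. -/
def scatA (φPlus φMinus : ℝ → ℝ → ℝ → Mat4) (z : ℝ) : Mat4 :=
  (φPlus 0 0 z)⁻¹ * φMinus 0 0 z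

/-- The scattering matrix `B(z) = A(z)⁻¹`. -/
def scatB (φPlus φMinus : ℝ → ℝ → ℝ → Mat4) (z : ℝ) : Mat4 :=
  (scatA φPlus φMinus z)⁻¹

/-- The minor of `A` with rows `r` and columns `c`. -/
def minor {p : ℕ} (A : Mat4) (r c : Fin p → Fin 4) : ℂ := (A.submatrix r c).det

/-- The four analytic non-principal minors of `A` vanish. In the usual one-based indices: rows
`1,2` and columns `1,3`; rows `1,3` and columns `1,2` (both analytic for `Im z > 0`); rows `2,4`
and columns `3,4`; rows `3,4` and columns `2,4` (both analytic for `Im z < 0`). -/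
def NonprincipalMinorsVanish (A : Mat4) : Prop :=
  minor A ![0, 1] ![0, 2] = 0 ∧ minor A ![0, 2] ![0, 1] = 0 ∧
  minor A ![1, 3] ![2, 3] = 0 ∧ minor A ![2, 3] ![1, 3] = 0

/-- The six analytic principal minors of `A`, which are the denominators in the definition of the
sectionally meromorphic matrix, do not vanish. In the usual one-based indices these are the minors
on `1`; `1,2`; `1,2,3` (analytic for `Im z > 0`) and on `4`; `3,4`; `2,3,4` (analytic for
`Im z < 0`). -/
def PrincipalMinorsNonzero (A : Mat4) : Prop :=
  minor A ![0] ![0] ≠ 0 ∧ minor A ![0, 1] ![0, 1] ≠ 0 ∧ minor A ![0, 1, 2] ![0, 1, 2] ≠ 0 ∧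
  minor A ![3] ![3] ≠ 0 ∧ minor A ![2, 3] ![2, 3] ≠ 0 ∧ minor A ![1, 2, 3] ![1, 2, 3] ≠ 0

/-- Column `j` of a matrix. -/
def column (φ : Mat4) (j : Fin 4) : Fin 4 → ℂ := fun i => φ i j

/-! The auxiliary analytic eigenfunctions on the real axis, from the triangular decompositions of
the scattering matrix. `φ` stands for `φ₊(x,t,z)` and `A` for `A(z)`. -/

/-- `χ₂⁺ = A_{[1,2]} φ₊,₂ + A_{1,3;1,2} φ₊,₃ + A_{1,4;1,2} φ₊,₄`, which is also
`A_{[1]} φ₋,₂ - a₁₂ φ₋,₁`. -/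
def chi2Plus (φ A : Mat4) : Fin 4 → ℂ :=
  minor A ![0, 1] ![0, 1] • column φ 1 + minor A ![0, 2] ![0, 1] • column φ 2
    + minor A ![0, 3] ![0, 1] • column φ 3

/-- `χ₃⁺ = A_{[1,2,3]} φ₊,₃ + A_{1,2,4;1,2,3} φ₊,₄`. -/
def chi3Plus (φ A : Mat4) : Fin 4 → ℂ :=
  minor A ![0, 1, 2] ![0, 1, 2] • column φ 2 + minor A ![0, 1, 3] ![0, 1, 2] • column φ 3

/-- `χ₂⁻ = A_{1,3,4;2,3,4} φ₊,₁ + A_{[2,3,4]} φ₊,₂`. -/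
def chi2Minus (φ A : Mat4) : Fin 4 → ℂ :=
  minor A ![0, 2, 3] ![1, 2, 3] • column φ 0 + minor A ![1, 2, 3] ![1, 2, 3] • column φ 1

/-- `χ₃⁻ = A_{1,4;3,4} φ₊,₁ + A_{2,4;3,4} φ₊,₂ + A_{[3,4]} φ₊,₃`, which is also
`A_{[4]} φ₋,₃ - a₄₃ φ₋,₄`. -/
def chi3Minus (φ A : Mat4) : Fin 4 → ℂ :=
  minor A ![0, 3] ![2, 3] • column φ 0 + minor A ![1, 3] ![2, 3] • column φ 1
    + minor A ![2, 3] ![2, 3] • column φ 2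

/-- The value on the real axis, from above, of the meromorphic matrix of the Riemann-Hilbert
problem,
`M⁺ = (φ₋,₁/A_{[1]}, (χ₂⁺ - (A_{1,3;1,2}/A_{[1,2,3]}) χ₃⁺)/A_{[1,2]}, χ₃⁺/A_{[1,2,3]}, φ₊,₄) e^{-iΘ}`. -/
def matMPlus (q₀ : ℝ) (φPlus φMinus : ℝ → ℝ → ℝ → Mat4) (x t z : ℝ) : Mat4 :=
  let A := scatA φPlus φMinus z
  let φp := φPlus x t z
  let φm := φMinus x t z
  (Matrix.of
    ![(minor A ![0] ![0])⁻¹ • column φm 0,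
      (minor A ![0, 1] ![0, 1])⁻¹ • (chi2Plus φp A
        - (minor A ![0, 2] ![0, 1] / minor A ![0, 1, 2] ![0, 1, 2]) • chi3Plus φp A),
      (minor A ![0, 1, 2] ![0, 1, 2])⁻¹ • chi3Plus φp A,
      column φp 3]).transpose * expNegTheta q₀ x t z

/-- The value on the real axis, from below, of the meromorphic matrix of the Riemann-Hilbert
problem,
`M⁻ = (φ₊,₁, χ₂⁻/A_{[2,3,4]}, (χ₃⁻ - (A_{2,4;3,4}/A_{[2,3,4]}) χ₂⁻)/A_{[3,4]}, φ₋,₄/A_{[4]}) e^{-iΘ}`. -/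
def matMMinus (q₀ : ℝ) (φPlus φMinus : ℝ → ℝ → ℝ → Mat4) (x t z : ℝ) : Mat4 :=
  let A := scatA φPlus φMinus z
  let φp := φPlus x t z
  let φm := φMinus x t z
  (Matrix.of
    ![column φp 0,
      (minor A ![1, 2, 3] ![1, 2, 3])⁻¹ • chi2Minus φp A,
      (minor A ![2, 3] ![2, 3])⁻¹ • (chi3Minus φp A
        - (minor A ![1, 3] ![2, 3] / minor A ![1, 2, 3] ![1, 2, 3]) • chi2Minus φp A),
      (minor A ![3] ![3])⁻¹ • column φm 3]).transpose * expNegTheta q₀ x t z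

/-- `L` is the jump matrix of the Riemann-Hilbert problem:
`M⁺(x,t,z) = M⁻(x,t,z) (I - e^{iΘ} L(z) e^{-iΘ})` for all `(x,t)` and all `z` in the continuous
spectrum. -/
def IsJumpMatrix (q₀ : ℝ) (φPlus φMinus : ℝ → ℝ → ℝ → Mat4) (L : ℝ → Mat4) : Prop :=
  ∀ z ∈ contSpec q₀, ∀ x t,
    matMPlus q₀ φPlus φMinus x t z = matMMinus q₀ φPlus φMinus x t z *
      (1 - expTheta q₀ x t z * L z * expNegTheta q₀ x t z)

end VNLS

end

/-! Both Lax matrices `Y` satisfy `Y†J + JY = 0`, so `F†JG` is constant for any two solutions. For a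
Jost eigenfunction this constant is `E†JE`, a diagonal matrix that is invertible away from the
branch points (`IsJost.form_eq`). Hence the Jost matrices are invertible, and constancy of `φ₊†Jφ₋`
gives `φ₋ = φ₊A` at every `(x,t)`.

When the non-principal minors vanish, `M± = φ₊ N± e^{-iΘ}`, where `N±` depend on `z` only, `N⁺` is
unit lower triangular and `N⁻` unit upper triangular. The jump relation becomes `N⁺ = N⁻(I - L)`,
which forces `L = I - (N⁻)⁻¹N⁺`. So `L = 0` means `N⁺ = N⁻`; both are then the identity, and
together with the vanishing minors this annihilates every off-diagonal entry of `A`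
(`factorPlus_eq_factorMinus_iff`). -/

namespace VNLS

open Filter Topology Matrix

/-! ### Conserved sesquilinear forms of `J`-skew linear systems -/

/-- If `F' = Y F` and `G' = Y G` entrywise, with `Y† J + J Y = 0`, then `F† J G` is constant. -/
theorem conjTranspose_mul_matJ_mul_const {F G Y : ℝ → Mat4}
    (hF : ∀ s i j, HasDerivAt (fun y => F y i j) ((Y s * F s) i j) s)
    (hG : ∀ s i j, HasDerivAt (fun y => G y i j) ((Y s * G s) i j) s)
    (hY : ∀ s, (Y s)ᴴ * matJ + matJ * Y s = 0) (a b : ℝ) :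
    (F a)ᴴ * matJ * G a = (F b)ᴴ * matJ * G b := by
  ext i j
  have key : ∀ s, HasDerivAt (fun y => ((F y)ᴴ * (matJ * G y)) i j) 0 s := by
    intro s
    have hJG : ∀ k, HasDerivAt (fun y => (matJ * G y) k j) ((matJ * (Y s * G s)) k j) s := by
      intro k
      simp only [Matrix.mul_apply (M := matJ)]
      exact HasDerivAt.fun_sum fun l _ => (hG s l j).const_mul _
    have hsum : HasDerivAt (fun y => ((F y)ᴴ * (matJ * G y)) i j)
        (((Y s * F s)ᴴ * (matJ * G s) + (F s)ᴴ * (matJ * (Y s * G s))) i j) s := by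
      simp only [Matrix.add_apply, Matrix.mul_apply (M := (F _)ᴴ),
        Matrix.mul_apply (M := (Y s * F s)ᴴ), ← Finset.sum_add_distrib]
      exact HasDerivAt.fun_sum fun l _ => ((hF s l i).star).mul (hJG l)
    convert hsum using 1
    have : (Y s * F s)ᴴ * (matJ * G s) + (F s)ᴴ * (matJ * (Y s * G s))
        = (F s)ᴴ * ((Y s)ᴴ * matJ + matJ * Y s) * G s := by
      rw [Matrix.conjTranspose_mul]
      noncomm_ring
    rw [this, hY]
    simp
  rw [Matrix.mul_assoc, Matrix.mul_assoc]
  exact is_const_of_deriv_eq_zero (fun s => (key s).differentiableAt) (fun s => (key s).deriv) a b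

theorem matQ_isHermitian (v : Fin 3 → ℂ) : (matQ v)ᴴ = matQ v := by
  ext i j
  fin_cases i <;> fin_cases j <;> simp [matQ]

theorem matJ_isHermitian : matJᴴ = matJ := by
  ext i j
  fin_cases i <;> fin_cases j <;> simp [matJ]

theorem matJ_mul_self : matJ * matJ = 1 := by
  ext i j
  fin_cases i <;> fin_cases j <;> simp [matJ]

theorem matQ_mul_matJ (v : Fin 3 → ℂ) : matQ v * matJ = -(matJ * matQ v) := by
  ext i j
  fin_cases i <;> fin_cases j <;> simp [matQ, matJ]

/-- As `k` is real, `-ikJ` is anti-Hermitian and commutes with `J`, while `Q` is Hermitian and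
anticommutes with `J`. -/
theorem laxX_skew (q₀ : ℝ) (q : ℝ → ℝ → Fin 3 → ℂ) (x t z : ℝ) :
    (laxX q₀ q x t z)ᴴ * matJ + matJ * laxX q₀ q x t z = 0 := by
  simp [laxX, matQ_isHermitian, matJ_isHermitian, add_mul, mul_add, matJ_mul_self, matQ_mul_matJ]
  abel

theorem laxT_skew (q₀ : ℝ) (q : ℝ → ℝ → Fin 3 → ℂ) (x t z : ℝ) :
    (laxT q₀ q x t z)ᴴ * matJ + matJ * laxT q₀ q x t z = 0 := by
  simp only [laxT]
  -- Only the Hermitian symmetry of this factor `P` matters: then `(-iJP)†J = iP` cancels `J(-iJP) =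
  -- -iP`.
  generalize hP : matQ (fun j => deriv (fun y => q y t j) x)
    - matQ (q x t) ^ 2 + ((q₀ : ℂ) ^ 2) • (1 : Mat4) = P
  have hP' : Pᴴ = P := by
    rw [← hP]
    simp [matQ_isHermitian, Matrix.conjTranspose_pow]
  simp only [Matrix.conjTranspose_sub, Matrix.conjTranspose_smul, Matrix.conjTranspose_mul,
    matQ_isHermitian, matJ_isHermitian, hP', sub_mul, mul_sub, Matrix.smul_mul, Matrix.mul_smul,
    matJ_mul_self, matQ_mul_matJ]
  rw [Matrix.mul_assoc P, matJ_mul_self, ← Matrix.mul_assoc matJ matJ P, matJ_mul_self]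
  simp

/-! ### Jost eigenfunctions -/

/-- `E† J E`, the conserved form of a Jost eigenfunction. -/
noncomputable def jostForm (q₀ z : ℝ) : Mat4 :=
  Matrix.diagonal ![1 - (q₀ : ℂ) ^ 2 / (z : ℂ) ^ 2, -1, -1, -(1 - (q₀ : ℂ) ^ 2 / (z : ℂ) ^ 2)]

theorem isUnit_jostForm {q₀ z : ℝ} (hz : z ∈ contSpec q₀) : IsUnit (jostForm q₀ z) := by
  rw [Matrix.isUnit_iff_isUnit_det, isUnit_iff_ne_zero]
  obtain ⟨h0, h1, h2⟩ := hz
  have hz' : (z : ℂ) ≠ 0 := by exact_mod_cast h0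
  have hne : (1 : ℂ) - (q₀ : ℂ) ^ 2 / (z : ℂ) ^ 2 ≠ 0 := by
    intro h
    rw [sub_eq_zero, eq_comm, div_eq_one_iff_eq (pow_ne_zero 2 hz')] at h
    have h' : q₀ ^ 2 = z ^ 2 := by exact_mod_cast h
    rcases sq_eq_sq_iff_eq_or_eq_neg.1 h' with h' | h'
    · exact h1 h'.symm
    · exact h2 (by linarith)
  rw [jostForm, Matrix.det_diagonal, Fin.prod_univ_four]
  have hne' := neg_ne_zero.2 hne
  simpa using And.intro hne hne'

/-- Conceptually, `S = -(i/z)JQ` is Hermitian and anticommutes with `J`, so `E†JE = J(I - S²) = J(I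
- Q²/z²)`, and `Q² = diag(q₀², 0, 0, q₀²)` because `|c| = q₀`. -/
theorem matE_form {q₀ : ℝ} {c : ℂ} (hc : ‖c‖ = q₀) (z : ℝ) :
    (matE c z)ᴴ * matJ * matE c z = jostForm q₀ z := by
  have hcc : (starRingEnd ℂ) c * c = (q₀ : ℂ) ^ 2 := by
    rw [← hc, ← Complex.normSq_eq_conj_mul_self, Complex.normSq_eq_norm_sq]; push_cast; rfl
  have hE : matE c z = !![1, 0, 0, -(Complex.I / z * (starRingEnd ℂ) c); 0, 1, 0, 0; 0, 0, 1, 0;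
      Complex.I / z * c, 0, 0, 1] := by
    ext i j
    fin_cases i <;> fin_cases j <;> simp [matE, matJ, matQ, bdryVec]
  have hE' : (matE c z)ᴴ = matE c z := by
    rw [hE]
    ext i j
    fin_cases i <;> fin_cases j <;> simp <;> ring
  have hJ : matJ = !![1, 0, 0, 0; 0, -1, 0, 0; 0, 0, -1, 0; 0, 0, 0, -1] := by
    ext i j
    fin_cases i <;> fin_cases j <;> simp [matJ]
  rw [hE', hE, hJ]
  have e : (Complex.I / z) * (Complex.I / z) * ((starRingEnd ℂ) c * c) = - (q₀ ^ 2 / z ^ 2) := by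
    rw [hcc, div_mul_div_comm, Complex.I_mul_I]; ring
  ext i j
  fin_cases i <;> fin_cases j <;>
    simp [jostForm] <;>
    first | ring1 | linear_combination e | linear_combination -e

theorem expTheta_conjTranspose (q₀ x t z : ℝ) :
    (expTheta q₀ x t z)ᴴ = expNegTheta q₀ x t z := by
  rw [expTheta, expNegTheta, Matrix.diagonal_conjTranspose]
  congr 1
  ext j
  simp [← Complex.exp_conj]

theorem expNegTheta_mul_expTheta (q₀ x t z : ℝ) :
    expNegTheta q₀ x t z * expTheta q₀ x t z = 1 := by
  simp [expTheta, expNegTheta, Matrix.diagonal_mul_diagonal, ← Complex.exp_add]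

theorem norm_expTheta_le (q₀ x t z : ℝ) (i j : Fin 4) : ‖expTheta q₀ x t z i j‖ ≤ 1 := by
  rw [expTheta, Matrix.diagonal_apply]
  split_ifs
  · rw [mul_comm, Complex.norm_exp_ofReal_mul_I]
  · simp

/-- The leading-order form of a Jost eigenfunction does not depend on `x` and `t`. -/
theorem leading_form {q₀ : ℝ} {c : ℂ} (hc : ‖c‖ = q₀) (x t z : ℝ) :
    (matE c z * expTheta q₀ x t z)ᴴ * matJ * (matE c z * expTheta q₀ x t z) = jostForm q₀ z := by
  have hcomm : jostForm q₀ z * expTheta q₀ x t z = expTheta q₀ x t z * jostForm q₀ z := by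
    simp only [jostForm, expTheta, Matrix.diagonal_mul_diagonal, mul_comm]
  calc _ = expNegTheta q₀ x t z * ((matE c z)ᴴ * matJ * matE c z * expTheta q₀ x t z) := by
        rw [Matrix.conjTranspose_mul, expTheta_conjTranspose]; noncomm_ring
    _ = _ := by
        rw [matE_form hc, hcomm, ← Matrix.mul_assoc, expNegTheta_mul_expTheta, Matrix.one_mul]

/-- Products of a bounded and an infinitesimal matrix function are infinitesimal. -/
theorem tendsto_mul_zero_of_bounded {l : Filter ℝ} {P R : ℝ → Mat4} {C : ℝ}
    (hP : ∀ x i j, ‖P x i j‖ ≤ C) (hR : Tendsto R l (𝓝 0)) :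
    Tendsto (fun x => P x * R x) l (𝓝 0) := by
  refine tendsto_pi_nhds.2 fun i => tendsto_pi_nhds.2 fun j => ?_
  simp only [Matrix.mul_apply, Matrix.zero_apply]
  rw [← Finset.sum_const_zero (s := (Finset.univ : Finset (Fin 4)))]
  refine tendsto_finsetSum _ fun k _ => ?_
  have hRk : Tendsto (fun x => R x k j) l (𝓝 0) := tendsto_pi_nhds.1 (tendsto_pi_nhds.1 hR k) j
  refine squeeze_zero_norm (a := fun x => C * ‖R x k j‖) (fun x => ?_) ?_
  · rw [norm_mul]
    exact mul_le_mul_of_nonneg_right (hP x i k) (norm_nonneg _)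
  · simpa using hRk.norm.const_mul C

/-- `Θ` is real, so the exponentials have modulus one. The bound is uniform in `x`, as needed to
absorb the `o(1)` error of the Jost asymptotics. -/
theorem exists_bound_leading (q₀ t z : ℝ) (c : ℂ) :
    ∃ C : ℝ, ∀ x i j, ‖(matE c z * expTheta q₀ x t z) i j‖ ≤ C := by
  refine ⟨∑ i, ∑ k, ‖matE c z i k‖, fun x i j => ?_⟩
  rw [Matrix.mul_apply]
  calc _ ≤ ∑ k, ‖matE c z i k * expTheta q₀ x t z k j‖ := norm_sum_le _ _
    _ ≤ ∑ k, ‖matE c z i k‖ := by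
        refine Finset.sum_le_sum fun k _ => ?_
        rw [norm_mul]
        exact mul_le_of_le_one_right (norm_nonneg _) (norm_expTheta_le q₀ x t z k j)
    _ ≤ _ := Finset.single_le_sum (f := fun i => ∑ k, ‖matE c z i k‖)
        (fun _ _ => Finset.sum_nonneg fun _ _ => norm_nonneg _) (Finset.mem_univ i)

/-- The conservation law `φ† J φ = E† J E` for the Jost eigenfunctions. -/
theorem IsJost.form_eq {q₀ : ℝ} {q : ℝ → ℝ → Fin 3 → ℂ} {c : ℂ} {l : Filter ℝ} [l.NeBot]
    {φ : ℝ → ℝ → ℝ → Mat4} (h : IsJost q₀ q c l φ) (hc : ‖c‖ = q₀) {z : ℝ}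
    (hz : z ∈ contSpec q₀) (x t : ℝ) : (φ x t z)ᴴ * matJ * φ x t z = jostForm q₀ z := by
  -- Write `φ = W + R` with bounded leading term `W` and error `R → 0`. In `φ†Jφ` every term except
  -- `W†JW` tends to zero.
  set W : ℝ → Mat4 := fun y => matE c z * expTheta q₀ y t z with hW
  set R : ℝ → Mat4 := fun y => φ y t z - W y with hRdef
  have hR : Tendsto R l (𝓝 0) := h.asymptotics z hz t
  obtain ⟨C, hC⟩ := exists_bound_leading q₀ t z c
  have hWR : Tendsto (fun y => (W y)ᴴ * (matJ * R y)) l (𝓝 0) := by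
    refine tendsto_mul_zero_of_bounded (C := C) (fun y i j => ?_) ?_
    · rw [Matrix.conjTranspose_apply, norm_star]; exact hC y j i
    · simpa using (tendsto_const_nhds (x := matJ)).mul hR
  have hadj {P : ℝ → Mat4} (hP : Tendsto P l (𝓝 0)) : Tendsto (fun y => (P y)ᴴ) l (𝓝 0) := by
    have h0 := (Continuous.matrix_conjTranspose (continuous_id (X := Mat4))).tendsto 0
    rw [id, Matrix.conjTranspose_zero] at h0
    exact h0.comp hP
  have hRW : Tendsto (fun y => (R y)ᴴ * matJ * W y) l (𝓝 0) := by
    refine (hadj hWR).congr fun y => ?_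
    simp [Matrix.conjTranspose_mul, matJ_isHermitian]
  have hRR : Tendsto (fun y => (R y)ᴴ * matJ * R y) l (𝓝 0) := by
    simpa using ((hadj hR).mul (tendsto_const_nhds (x := matJ))).mul hR
  have hlim : Tendsto (fun y => (φ y t z)ᴴ * matJ * φ y t z) l (𝓝 (jostForm q₀ z)) := by
    have h1 := ((tendsto_const_nhds (x := jostForm q₀ z)).add hWR).add (hRW.add hRR)
    simp only [add_zero] at h1
    refine h1.congr fun y => ?_
    have hφ : φ y t z = W y + R y := by simp [hRdef]
    rw [hφ, ← leading_form hc y t z, Matrix.conjTranspose_add]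
    noncomm_ring
  -- The form is constant in `x`, hence equal to its limit.
  refine tendsto_nhds_unique (f := fun _ : ℝ => (φ x t z)ᴴ * matJ * φ x t z)
    tendsto_const_nhds (hlim.congr fun y => ?_)
  exact conjTranspose_mul_matJ_mul_const (fun s => h.eq_x z hz s t) (fun s => h.eq_x z hz s t)
    (fun s => laxX_skew q₀ q s t z) y x

theorem IsJost.isUnit {q₀ : ℝ} {q : ℝ → ℝ → Fin 3 → ℂ} {c : ℂ} {l : Filter ℝ} [l.NeBot]
    {φ : ℝ → ℝ → ℝ → Mat4} (h : IsJost q₀ q c l φ) (hc : ‖c‖ = q₀) {z : ℝ}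
    (hz : z ∈ contSpec q₀) (x t : ℝ) : IsUnit (φ x t z) := by
  have hu := isUnit_jostForm hz
  rw [← h.form_eq hc hz x t, Matrix.isUnit_iff_isUnit_det, Matrix.det_mul] at hu
  rw [Matrix.isUnit_iff_isUnit_det]
  exact isUnit_of_mul_isUnit_right hu

/-- The scattering relation `φ₋ = φ₊ A` at every point `(x, t)`. -/
theorem scattering_relation {q₀ : ℝ} {q : ℝ → ℝ → Fin 3 → ℂ} {c c' : ℂ} {l l' : Filter ℝ}
    [l.NeBot] {φPlus φMinus : ℝ → ℝ → ℝ → Mat4} (hp : IsJost q₀ q c l φPlus)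
    (hm : IsJost q₀ q c' l' φMinus) (hc : ‖c‖ = q₀) {z : ℝ} (hz : z ∈ contSpec q₀) (x t : ℝ) :
    φMinus x t z = φPlus x t z * scatA φPlus φMinus z := by
  have hunit := hp.isUnit hc hz
  have hzero : φPlus 0 0 z * scatA φPlus φMinus z = φMinus 0 0 z := by
    rw [scatA, ← Matrix.mul_assoc, Matrix.mul_nonsing_inv _
      ((Matrix.isUnit_iff_isUnit_det _).1 (hunit 0 0)), Matrix.one_mul]
  -- The path to the origin has two legs: along `x` at fixed `t`, then along `t` at `x = 0`.
  have hconst : (φPlus x t z)ᴴ * matJ * φMinus x t z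
      = (φPlus 0 0 z)ᴴ * matJ * φMinus 0 0 z :=
    (conjTranspose_mul_matJ_mul_const (fun s => hp.eq_x z hz s t) (fun s => hm.eq_x z hz s t)
      (fun s => laxX_skew q₀ q s t z) x 0).trans
    (conjTranspose_mul_matJ_mul_const (F := fun s => φPlus 0 s z) (G := fun s => φMinus 0 s z)
      (fun s => hp.eq_t z hz 0 s) (fun s => hm.eq_t z hz 0 s)
      (fun s => laxT_skew q₀ q 0 s z) t 0)
  have hU : IsUnit ((φPlus x t z)ᴴ * matJ) := by
    have hu := isUnit_jostForm hz
    rw [← hp.form_eq hc hz x t, Matrix.isUnit_iff_isUnit_det, Matrix.det_mul] at hu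
    rw [Matrix.isUnit_iff_isUnit_det]
    exact isUnit_of_mul_isUnit_left hu
  -- After multiplication by `φ₊†J`, both sides equal `E†JE · A`.
  refine hU.mul_left_cancel ?_
  rw [hconst, ← Matrix.mul_assoc, hp.form_eq hc hz x t, ← hzero, ← Matrix.mul_assoc,
    hp.form_eq hc hz 0 0]

/-! ### The triangular factors of the Riemann-Hilbert matrices -/

/-- The matrix `N⁺` with `M⁺ = φ₊ N⁺ e^{-iΘ}`, for vanishing non-principal minors. -/
noncomputable def factorPlus (A : Mat4) : Mat4 :=
  !![1, 0, 0, 0;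
     A 1 0 / A 0 0, 1, 0, 0;
     A 2 0 / A 0 0, 0, 1, 0;
     A 3 0 / A 0 0, minor A ![0, 3] ![0, 1] / minor A ![0, 1] ![0, 1],
       minor A ![0, 1, 3] ![0, 1, 2] / minor A ![0, 1, 2] ![0, 1, 2], 1]

/-- The matrix `N⁻` with `M⁻ = φ₊ N⁻ e^{-iΘ}`, for vanishing non-principal minors. -/
noncomputable def factorMinus (A : Mat4) : Mat4 :=
  !![1, minor A ![0, 2, 3] ![1, 2, 3] / minor A ![1, 2, 3] ![1, 2, 3],
       minor A ![0, 3] ![2, 3] / minor A ![2, 3] ![2, 3], A 0 3 / A 3 3;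
     0, 1, 0, A 1 3 / A 3 3;
     0, 0, 1, A 2 3 / A 3 3;
     0, 0, 0, 1]

theorem minor_one (A : Mat4) (i j : Fin 4) : minor A ![i] ![j] = A i j := by
  rw [minor, Matrix.det_fin_one]; rfl

theorem minor_two (A : Mat4) (i j k l : Fin 4) :
    minor A ![i, j] ![k, l] = A i k * A j l - A i l * A j k := by
  rw [minor, Matrix.det_fin_two]; rfl

theorem minor_three (A : Mat4) (i j k l m n : Fin 4) :
    minor A ![i, j, k] ![l, m, n] =
      A i l * A j m * A k n - A i l * A j n * A k m - A i m * A j l * A k n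
        + A i m * A j n * A k l + A i n * A j l * A k m - A i n * A j m * A k l := by
  rw [minor, Matrix.det_fin_three]; rfl

theorem isUnit_factorMinus (A : Mat4) : IsUnit (factorMinus A) := by
  rw [Matrix.isUnit_iff_isUnit_det]
  have : (factorMinus A).det = 1 := by
    simp [factorMinus, Matrix.det_succ_row_zero, Fin.sum_univ_succ, Fin.succAbove]
  simp [this]

/-- Column 1 uses `φ₋ = φ₊A`. In column 2, `A_{1,3;1,2} = 0` removes both the `φ₊,₃` term and the
`χ₃⁺` correction; `A_{2,4;3,4}` plays this role for `M⁻`. -/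
theorem matMPlus_eq {q₀ : ℝ} {φPlus φMinus : ℝ → ℝ → ℝ → Mat4} {x t z : ℝ}
    (hP : PrincipalMinorsNonzero (scatA φPlus φMinus z))
    (hN : NonprincipalMinorsVanish (scatA φPlus φMinus z))
    (hrel : φMinus x t z = φPlus x t z * scatA φPlus φMinus z) :
    matMPlus q₀ φPlus φMinus x t z =
      φPlus x t z * factorPlus (scatA φPlus φMinus z) * expNegTheta q₀ x t z := by
  obtain ⟨h1, h2, h3, -, -, -⟩ := hP
  obtain ⟨-, hn, -, -⟩ := hN
  simp only [matMPlus, hrel]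
  congr 1
  generalize scatA φPlus φMinus z = A at *
  rw [minor_one] at *
  ext i j
  fin_cases j <;>
    simp [factorPlus, chi2Plus, chi3Plus, column, hn, Matrix.mul_apply, Fin.sum_univ_four] <;>
    field_simp

theorem matMMinus_eq {q₀ : ℝ} {φPlus φMinus : ℝ → ℝ → ℝ → Mat4} {x t z : ℝ}
    (hP : PrincipalMinorsNonzero (scatA φPlus φMinus z))
    (hN : NonprincipalMinorsVanish (scatA φPlus φMinus z))
    (hrel : φMinus x t z = φPlus x t z * scatA φPlus φMinus z) :
    matMMinus q₀ φPlus φMinus x t z =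
      φPlus x t z * factorMinus (scatA φPlus φMinus z) * expNegTheta q₀ x t z := by
  obtain ⟨-, -, -, h1, h2, h3⟩ := hP
  obtain ⟨-, -, hn, -⟩ := hN
  simp only [matMMinus, hrel]
  congr 1
  generalize scatA φPlus φMinus z = A at *
  rw [minor_one] at *
  ext i j
  fin_cases j <;>
    simp [factorMinus, chi2Minus, chi3Minus, column, hn, Matrix.mul_apply, Fin.sum_univ_four] <;>
    field_simp

/-- The triangular factors agree exactly when the scattering matrix is diagonal. -/
theorem factorPlus_eq_factorMinus_iff {A : Mat4} (hP : PrincipalMinorsNonzero A)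
    (hN : NonprincipalMinorsVanish A) : factorPlus A = factorMinus A ↔ A.IsDiag := by
  obtain ⟨p1, p2, p3, p4, p5, p6⟩ := hP
  constructor
  · intro h
    have e (i j : Fin 4) : factorPlus A i j = factorMinus A i j := by rw [h]
    obtain ⟨n1, n2, -, -⟩ := hN
    simp only [minor_one] at p1 p4
    -- Comparing a lower with an upper triangular matrix kills the outer columns of `A` off the
    -- diagonal, and the minors in the inner columns.
    have e10 : A 1 0 = 0 := by simpa [factorPlus, factorMinus, p1] using e 1 0
    have e20 : A 2 0 = 0 := by simpa [factorPlus, factorMinus, p1] using e 2 0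
    have e30 : A 3 0 = 0 := by simpa [factorPlus, factorMinus, p1] using e 3 0
    have e03 : A 0 3 = 0 := by simpa [factorPlus, factorMinus, p4] using (e 0 3).symm
    have e13 : A 1 3 = 0 := by simpa [factorPlus, factorMinus, p4] using (e 1 3).symm
    have e23 : A 2 3 = 0 := by simpa [factorPlus, factorMinus, p4] using (e 2 3).symm
    have m31 : minor A ![0, 3] ![0, 1] = 0 := by
      simpa [factorPlus, factorMinus, p2] using e 3 1
    have m32 : minor A ![0, 1, 3] ![0, 1, 2] = 0 := by
      simpa [factorPlus, factorMinus, p3] using e 3 2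
    have m01 : minor A ![0, 2, 3] ![1, 2, 3] = 0 := by
      simpa [factorPlus, factorMinus, p6] using (e 0 1).symm
    have m02 : minor A ![0, 3] ![2, 3] = 0 := by
      simpa [factorPlus, factorMinus, p5] using (e 0 2).symm
    -- With the outer columns cleared, each of these four 2×2 minors is a single entry times `a₁₁`
    -- or `a₄₄`, up to sign.
    have e12 : A 1 2 = 0 := by simpa [minor_two, e10, p1] using n1
    have e21 : A 2 1 = 0 := by simpa [minor_two, e20, p1] using n2
    have e31 : A 3 1 = 0 := by simpa [minor_two, e30, p1] using m31
    have e02 : A 0 2 = 0 := by simpa [minor_two, e03, p4] using m02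
    have e11 : A 1 1 ≠ 0 := fun h => p2 (by simp [minor_two, e10, h])
    have e22 : A 2 2 ≠ 0 := fun h => p5 (by simp [minor_two, e23, h])
    -- The remaining 3×3 minors collapse to `a₁₁a₂₂a₄₃` and `a₁₂a₃₃a₄₄`.
    have e32 : A 3 2 = 0 := by
      simpa [minor_three, e10, e30, e12, e31, p1, e11] using m32
    have e01 : A 0 1 = 0 := by
      simpa [minor_three, e02, e03, e21, e23, p4, e22] using m01
    intro i j hij
    fin_cases i <;> fin_cases j <;> simp_all
  · intro h
    have e {i j : Fin 4} (hij : i ≠ j) : A i j = 0 := h hij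
    have e10 : A 1 0 = 0 := e (by decide)
    have e20 : A 2 0 = 0 := e (by decide)
    have e30 : A 3 0 = 0 := e (by decide)
    have e31 : A 3 1 = 0 := e (by decide)
    have e32 : A 3 2 = 0 := e (by decide)
    have e01 : A 0 1 = 0 := e (by decide)
    have e02 : A 0 2 = 0 := e (by decide)
    have e03 : A 0 3 = 0 := e (by decide)
    have e13 : A 1 3 = 0 := e (by decide)
    have e23 : A 2 3 = 0 := e (by decide)
    simp [factorPlus, factorMinus, minor_two, minor_three, e10, e20, e30, e31, e32, e01, e02, e03,
      e13, e23]

theorem isDiag_inv {A : Mat4} (h : A.IsDiag) : (A⁻¹).IsDiag := by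
  rw [← h.diagonal_diag, Matrix.inv_diagonal]
  exact Matrix.isDiag_diagonal _

/-- The jump relation at one point determines the jump matrix through the triangular factors. -/
theorem jump_iff {Φ P R e e' L : Mat4} (hΦ : IsUnit Φ) (he : e' * e = 1) :
    Φ * P * e' = Φ * R * e' * (1 - e * L * e') ↔ P = R * (1 - L) := by
  have h : Φ * R * e' * (1 - e * L * e') = Φ * (R * (1 - L)) * e' := by
    calc _ = Φ * R * e' - Φ * R * (e' * e) * L * e' := by noncomm_ring
      _ = _ := by rw [he]; noncomm_ring
  have he' : IsUnit e' := IsUnit.of_mul_eq_one e he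
  rw [h, he'.mul_left_inj, hΦ.mul_right_inj]

end VNLS

theorem lemmaL
    (q₀ : ℝ) (hq₀ : 0 < q₀)
    (qPlus qMinus : ℂ) (hqPlus : ‖qPlus‖ = q₀) (hqMinus : ‖qMinus‖ = q₀)
    (q : ℝ → ℝ → Fin 3 → ℂ)
    (hsol : VNLS.IsSolution q₀ q)
    (hbdry : VNLS.HasBoundaryValues qPlus qMinus q)
    (φPlus φMinus : ℝ → ℝ → ℝ → VNLS.Mat4)
    (hφPlus : VNLS.IsJost q₀ q qPlus Filter.atTop φPlus)
    (hφMinus : VNLS.IsJost q₀ q qMinus Filter.atBot φMinus)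
    (hprincipal : ∀ z ∈ VNLS.contSpec q₀,
      VNLS.PrincipalMinorsNonzero (VNLS.scatA φPlus φMinus z))
    (hnonprincipal : ∀ z ∈ VNLS.contSpec q₀,
      VNLS.NonprincipalMinorsVanish (VNLS.scatA φPlus φMinus z)) :
    ∃ L : ℝ → VNLS.Mat4,
      VNLS.IsJumpMatrix q₀ φPlus φMinus L ∧
      (∀ L' : ℝ → VNLS.Mat4, VNLS.IsJumpMatrix q₀ φPlus φMinus L' →
        ∀ z ∈ VNLS.contSpec q₀, L' z = L z) ∧
      ((∀ z ∈ VNLS.contSpec q₀,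
          (VNLS.scatA φPlus φMinus z).IsDiag ∧ (VNLS.scatB φPlus φMinus z).IsDiag) ↔
        ∀ z ∈ VNLS.contSpec q₀, L z = 0) := by
  have hrel := fun z (hz : z ∈ VNLS.contSpec q₀) x t =>
    VNLS.scattering_relation hφPlus hφMinus hqPlus hz x t
  -- The right-hand condition is free of `x` and `t`: one point determines `L z`, and the same `L z`
  -- then works at all points.
  have hjump : ∀ (L : ℝ → VNLS.Mat4) z, z ∈ VNLS.contSpec q₀ → ∀ x t,
      VNLS.matMPlus q₀ φPlus φMinus x t z = VNLS.matMMinus q₀ φPlus φMinus x t z *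
        (1 - VNLS.expTheta q₀ x t z * L z * VNLS.expNegTheta q₀ x t z) ↔
      VNLS.factorPlus (VNLS.scatA φPlus φMinus z) =
        VNLS.factorMinus (VNLS.scatA φPlus φMinus z) * (1 - L z) := by
    intro L z hz x t
    rw [VNLS.matMPlus_eq (hprincipal z hz) (hnonprincipal z hz) (hrel z hz x t),
      VNLS.matMMinus_eq (hprincipal z hz) (hnonprincipal z hz) (hrel z hz x t)]
    exact VNLS.jump_iff (hφPlus.isUnit hqPlus hz x t) (VNLS.expNegTheta_mul_expTheta q₀ x t z)
  let L : ℝ → VNLS.Mat4 := fun z => 1 - (VNLS.factorMinus (VNLS.scatA φPlus φMinus z))⁻¹ *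
    VNLS.factorPlus (VNLS.scatA φPlus φMinus z)
  have hL : ∀ z, VNLS.factorPlus (VNLS.scatA φPlus φMinus z) =
      VNLS.factorMinus (VNLS.scatA φPlus φMinus z) * (1 - L z) := by
    intro z
    rw [sub_sub_cancel, ← Matrix.mul_assoc, Matrix.mul_nonsing_inv _
      ((Matrix.isUnit_iff_isUnit_det _).1 (VNLS.isUnit_factorMinus _)), Matrix.one_mul]
  refine ⟨L, fun z hz x t => (hjump L z hz x t).2 (hL z), fun L' hL' z hz => ?_,
    forall₂_congr fun z hz => ?_⟩
  · have h := (hL z).symm.trans ((hjump L' z hz 0 0).1 (hL' z hz 0 0))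
    exact (sub_right_injective ((VNLS.isUnit_factorMinus _).mul_left_cancel h)).symm
  -- Diagonality of `B = A⁻¹` follows from that of `A`, so only `A` has to be treated.
  · rw [VNLS.scatB, and_iff_left_of_imp VNLS.isDiag_inv,
      ← VNLS.factorPlus_eq_factorMinus_iff (hprincipal z hz) (hnonprincipal z hz)]
    constructor
    · intro h
      have h' := hL z
      rw [h] at h'
      have h1 := (VNLS.isUnit_factorMinus _).mul_left_cancel ((Matrix.mul_one _).trans h')
      exact sub_right_injective (h1.symm.trans (sub_zero 1).symm)
    · intro h
      have h' := hL z
      rwa [h, sub_zero, Matrix.mul_one] at h'
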